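/- Let $d \ge 3$ be an odd integer, let $X = \{1, \dots, d\}$, and let $T$ be the $d$-regular rooted tree whose vertices are the finite words over $X$ (the root is the empty word, the children of $u$ are the words $ux$ with $x \in X$, level $k$ is $X^k$). Let $\mathrm{Aut}(T)$ be the group of graph automorphisms of $T$ fixing the root. Let $G_d \le \mathrm{Aut}(T)$ be the group generated by $a_1, \dots, a_d$, where, with indices read cyclically modulo $d$, $a_i$ exchanges the letters $i$ and $i+1$ at the first level, its section at $i$ is $a_i$, its section at $i+1$ is $a_{i+1}$, and all its other first-level sections are trivial; that is, for every word $w$, $$a_i(i\,w) = (i+1)\,a_i(w), \qquad a_i((i+1)\,w) = i\,a_{i+1}(w), \qquad a_i(x\,w) = x\,w \quad (x \ne i, i+1).$$ For $G \le \mathrm{Aut}(T)$ let $\mathrm{St}_G(k)$ be the subgroup of the elements of $G$ fixing every vertex of level $k$; for a vertex $u$ let $\mathrm{Rist}_G(u)$ be the subgroup of the elements of $G$ fixing every vertex not of the form $uv$ with $v$ a word over $X$; and let $\mathrm{Rist}_G(k)$ be the subgroup generated by all $\mathrm{Rist}_G(u)$, $u \in X^k$. The group $G$ is a branch group if it acts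 transitively on every level and every $\mathrm{Rist}_G(k)$ has finite index in $G$. The rigid kernel of $G$ is the kernel of the natural homomorphism $$\varprojlim_k G/\mathrm{Rist}_G(k) \longrightarrow \varprojlim_k G/\mathrm{St}_G(k).$$ Then $G_d$ is a branch group, and its rigid kernel is infinite and is neither torsion nor torsion-free: it contains a nontrivial element of finite order and an element of infinite order. -/

import Mathlib

namespace RigidKernel

/-- The `d`-regular rooted tree: vertices are the finite words over `Fin d`, the root is the
empty word, and every word `u` is joined to its children `u x`, for `x : Fin d`. -/
def tree (d : ℕ) : SimpleGraph (List (Fin d)) where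
  Adj u v := (∃ x, v = u ++ [x]) ∨ (∃ x, u = v ++ [x])
  symm := ⟨fun _ _ h => h.symm⟩
  loopless := ⟨by
    rintro u (⟨x, h⟩ | ⟨x, h⟩) <;> simpa using congrArg List.length h⟩

/-- `Aut(T)`: the group of the graph automorphisms of the rooted tree that fix the root. -/
def treeAut (d : ℕ) : Subgroup (Equiv.Perm (List (Fin d))) where
  carrier := {g | g [] = [] ∧ ∀ u v, (tree d).Adj (g u) (g v) ↔ (tree d).Adj u v}
  one_mem' := ⟨rfl, fun _ _ => Iff.rfl⟩
  mul_mem' := by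
    rintro g h ⟨hg, hg'⟩ ⟨hh, hh'⟩
    refine ⟨by simp [hh, hg], fun u v => ?_⟩
    simp only [Equiv.Perm.mul_apply]
    rw [hg', hh']
  inv_mem' := by
    rintro g ⟨hg, hg'⟩
    refine ⟨by rw [Equiv.Perm.inv_eq_iff_eq]; exact hg.symm, fun u v => ?_⟩
    rw [← hg']
    simp

variable {d : ℕ}

theorem treeAut_append_singleton (g : treeAut d) (u : List (Fin d)) (x : Fin d) :
    ∃ y, g.1 (u ++ [x]) = g.1 u ++ [y] := by
  induction u using List.reverseRecOn generalizing x with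
  | nil =>
    have h := (g.2.2 [] [x]).2 (Or.inl ⟨x, rfl⟩)
    rw [g.2.1] at h
    rcases h with ⟨y, hy⟩ | ⟨y, hy⟩
    · exact ⟨y, by simpa [g.2.1] using hy⟩
    · simp at hy
  | append_singleton p z ih =>
    have h := (g.2.2 (p ++ [z]) (p ++ [z] ++ [x])).2 (Or.inl ⟨x, rfl⟩)
    rcases h with ⟨y, hy⟩ | ⟨y, hy⟩
    · exact ⟨y, hy⟩
    · obtain ⟨y', hy'⟩ := ih z
      rw [hy'] at hy
      have h1 := (List.append_inj' hy rfl).1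
      have h2 := congrArg List.length (g.1.injective h1)
      simp at h2

theorem treeAut_append (g : treeAut d) (u v : List (Fin d)) :
    ∃ w, w.length = v.length ∧ g.1 (u ++ v) = g.1 u ++ w := by
  induction v using List.reverseRecOn with
  | nil => exact ⟨[], rfl, by simp⟩
  | append_singleton p z ih =>
    obtain ⟨w, hw, hw'⟩ := ih
    obtain ⟨y, hy⟩ := treeAut_append_singleton g (u ++ p) z
    exact ⟨w ++ [y], by simp [hw], by rw [← List.append_assoc, hy, hw', List.append_assoc]⟩

theorem treeAut_length (g : treeAut d) (u : List (Fin d)) : (g.1 u).length = u.length := by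
  obtain ⟨w, hw, hw'⟩ := treeAut_append g [] u
  rw [g.2.1] at hw'
  simp only [List.nil_append] at hw'
  rw [hw', hw]

theorem treeAut_prefix (g : treeAut d) {u v : List (Fin d)} (h : u <+: v) : g.1 u <+: g.1 v := by
  obtain ⟨t, rfl⟩ := h
  obtain ⟨w, -, hw⟩ := treeAut_append g u t
  exact ⟨w, hw.symm⟩

/-- The action of the generator `a_i` on words, following the wreath recursion of `a_i`:
with `j = finRotate d i` the cyclic successor of `i`, it exchanges the letters `i` and `j`, its
section at `i` is `a_i`, its section at `j` is `a_j`, and its other sections are trivial. -/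
def genFun : Fin d → List (Fin d) → List (Fin d)
  | _, [] => []
  | i, x :: w =>
    if x = i then finRotate d i :: genFun i w
    else if x = finRotate d i then i :: genFun (finRotate d i) w
    else x :: w

/-- The inverse of `genFun i`. -/
def genInv : Fin d → List (Fin d) → List (Fin d)
  | _, [] => []
  | i, x :: w =>
    if x = finRotate d i then i :: genInv i w
    else if x = i then finRotate d i :: genInv (finRotate d i) w
    else x :: w

theorem genInv_genFun (i : Fin d) (w : List (Fin d)) : genInv i (genFun i w) = w := by
  induction w generalizing i with
  | nil => rfl
  | cons x w ih =>
    by_cases h : x = i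
    · simp [genFun, genInv, h, ih]
    · by_cases h' : x = finRotate d i
      · have : i ≠ finRotate d i := fun e => h (h'.trans e.symm)
        rw [genFun, if_neg h, if_pos h', genInv, if_neg this, if_pos rfl, ih, h']
      · rw [genFun, if_neg h, if_neg h', genInv, if_neg h', if_neg h]

theorem genFun_genInv (i : Fin d) (w : List (Fin d)) : genFun i (genInv i w) = w := by
  induction w generalizing i with
  | nil => rfl
  | cons x w ih =>
    by_cases h : x = finRotate d i
    · simp [genFun, genInv, h, ih]
    · by_cases h' : x = i
      · have : finRotate d i ≠ i := fun e => h (h'.trans e.symm)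
        rw [genInv, if_neg h, if_pos h', genFun, if_neg this, if_pos rfl, ih, h']
      · rw [genInv, if_neg h, if_neg h', genFun, if_neg h', if_neg h]

theorem genFun_append (i : Fin d) (u : List (Fin d)) (x : Fin d) :
    ∃ y, genFun i (u ++ [x]) = genFun i u ++ [y] := by
  induction u generalizing i with
  | nil =>
    simp only [List.nil_append, genFun]
    split_ifs <;> exact ⟨_, rfl⟩
  | cons z u ih =>
    simp only [List.cons_append, genFun]
    split_ifs
    · obtain ⟨y, hy⟩ := ih i
      exact ⟨y, by rw [hy]; rfl⟩
    · obtain ⟨y, hy⟩ := ih (finRotate d i)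
      exact ⟨y, by rw [hy]; rfl⟩
    · exact ⟨x, rfl⟩

theorem genInv_append (i : Fin d) (u : List (Fin d)) (x : Fin d) :
    ∃ y, genInv i (u ++ [x]) = genInv i u ++ [y] := by
  induction u generalizing i with
  | nil =>
    simp only [List.nil_append, genInv]
    split_ifs <;> exact ⟨_, rfl⟩
  | cons z u ih =>
    simp only [List.cons_append, genInv]
    split_ifs
    · obtain ⟨y, hy⟩ := ih i
      exact ⟨y, by rw [hy]; rfl⟩
    · obtain ⟨y, hy⟩ := ih (finRotate d i)
      exact ⟨y, by rw [hy]; rfl⟩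
    · exact ⟨x, rfl⟩

/-- The generator `a_i` as an automorphism of the rooted tree. -/
def gen (i : Fin d) : treeAut d :=
  ⟨⟨genFun i, genInv i, genInv_genFun i, genFun_genInv i⟩, by
    refine ⟨rfl, fun u v => ?_⟩
    have key : ∀ u v : List (Fin d),
        (∃ x, genFun i v = genFun i u ++ [x]) ↔ ∃ x, v = u ++ [x] := by
      intro u v
      constructor
      · rintro ⟨x, hx⟩
        obtain ⟨y, hy⟩ := genInv_append i (genFun i u) x
        rw [← hx, genInv_genFun, genInv_genFun] at hy
        exact ⟨y, hy⟩
      · rintro ⟨x, rfl⟩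
        exact genFun_append i u x
    exact or_congr (key u v) (key v u)⟩

/-- The group `G_d ≤ Aut(T)`, generated by `a_1, …, a_d`. -/
def groupG (d : ℕ) : Subgroup (treeAut d) :=
  Subgroup.closure (Set.range gen)

/-! ### Stabilizers and rigid stabilizers of levels -/

/-- `St_G(k)`: the elements of `G` that fix every vertex of level `k`. -/
def levelStab (G : Subgroup (treeAut d)) (k : ℕ) : Subgroup G where
  carrier := {g | ∀ u : List (Fin d), u.length = k → g.1.1 u = u}
  one_mem' := fun _ _ => rfl
  mul_mem' := by
    intro g h hg hh u hu
    change g.1.1 (h.1.1 u) = u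
    rw [hh u hu, hg u hu]
  inv_mem' := by
    intro g hg u hu
    change (g.1.1)⁻¹ u = u
    rw [Equiv.Perm.inv_eq_iff_eq]
    exact (hg u hu).symm

/-- `Rist_G(u)`: the elements of `G` that fix every vertex outside the subtree
`{u v | v a word}` rooted at `u`. -/
def rist (G : Subgroup (treeAut d)) (u : List (Fin d)) : Subgroup G where
  carrier := {g | ∀ w : List (Fin d), ¬ u <+: w → g.1.1 w = w}
  one_mem' := fun _ _ => rfl
  mul_mem' := by
    intro g h hg hh w hw
    change g.1.1 (h.1.1 w) = w
    rw [hh w hw, hg w hw]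
  inv_mem' := by
    intro g hg w hw
    change (g.1.1)⁻¹ w = w
    rw [Equiv.Perm.inv_eq_iff_eq]
    exact (hg w hw).symm

/-- `Rist_G(k)` for a level `k`: the subgroup generated by all `Rist_G(u)`, with `u` a vertex of
level `k`. -/
def levelRist (G : Subgroup (treeAut d)) (k : ℕ) : Subgroup G :=
  Subgroup.closure {g | ∃ u : List (Fin d), u.length = k ∧ g ∈ rist G u}

instance levelStab_normal (G : Subgroup (treeAut d)) (k : ℕ) : (levelStab G k).Normal where
  conj_mem := by
    intro n hn g u hu
    change g.1.1 (n.1.1 ((g.1.1)⁻¹ u)) = u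
    have h : ((g.1.1)⁻¹ u).length = k := by
      have := treeAut_length (g.1⁻¹) u
      rw [hu] at this
      exact this
    rw [hn _ h]
    simp

instance levelRist_normal (G : Subgroup (treeAut d)) (k : ℕ) : (levelRist G k).Normal where
  conj_mem := by
    intro n hn g
    induction hn using Subgroup.closure_induction with
    | mem n hn =>
      obtain ⟨u, hu, hn⟩ := hn
      refine Subgroup.subset_closure ⟨g.1.1 u, by rw [treeAut_length, hu], fun w hw => ?_⟩
      change g.1.1 (n.1.1 ((g.1.1)⁻¹ w)) = w
      have h : ¬ u <+: (g.1.1)⁻¹ w := by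
        intro h
        apply hw
        have := treeAut_prefix g.1 h
        simpa using this
      rw [hn _ h]
      simp
    | one => simp
    | mul a b _ _ ha hb =>
      have : g * (a * b) * g⁻¹ = (g * a * g⁻¹) * (g * b * g⁻¹) := by group
      rw [this]
      exact mul_mem ha hb
    | inv a _ ha =>
      have : g * a⁻¹ * g⁻¹ = (g * a * g⁻¹)⁻¹ := by group
      rw [this]
      exact inv_mem ha

theorem levelStab_antitone (G : Subgroup (treeAut d)) : Antitone (levelStab G) := by
  intro k l hkl g hg u hu
  rcases u with _ | ⟨x, u⟩
  · exact g.1.2.1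
  · have h1 : (x :: u ++ List.replicate (l - k) x).length = l := by
      rw [List.length_append, hu, List.length_replicate]; omega
    obtain ⟨w, -, hw⟩ := treeAut_append g.1 (x :: u) (List.replicate (l - k) x)
    rw [hg _ h1] at hw
    exact (List.append_inj hw (treeAut_length g.1 _).symm).1.symm

theorem levelRist_antitone (G : Subgroup (treeAut d)) : Antitone (levelRist G) := by
  intro k l hkl
  refine Subgroup.closure_mono ?_
  rintro g ⟨u, hu, hg⟩
  refine ⟨u.take k, by rw [List.length_take, hu]; omega, fun w hw => hg w fun h => hw ?_⟩
  exact (List.take_prefix k u).trans h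

theorem levelRist_le_levelStab (G : Subgroup (treeAut d)) (k : ℕ) :
    levelRist G k ≤ levelStab G k := by
  refine (Subgroup.closure_le _).2 ?_
  rintro g ⟨u, hu, hg⟩ w hw
  by_cases h : u <+: w
  · have e : u = w := h.eq_of_length (hu.trans hw.symm)
    subst e
    by_contra hne
    refine hne (g.1.1.injective (hg _ fun hp => hne ?_))
    exact (hp.eq_of_length (treeAut_length g.1 u).symm).symm
  · exact hg w h

/-- `G` is a branch group: it acts transitively on every level of the tree, and every level
rigid stabilizer has finite index in `G`. -/
def IsBranch (G : Subgroup (treeAut d)) : Prop :=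
  (∀ u v : List (Fin d), u.length = v.length → ∃ g : G, g.1.1 u = v) ∧
    ∀ k : ℕ, (levelRist G k).FiniteIndex

/-! ### Completions and the rigid kernel -/

section completion

variable {H : Type*} [Group H]

/-- The inverse limit of the quotients `H ⧸ N k` along the natural projections
`H ⧸ N l → H ⧸ N k`, `k ≤ l`, for a descending sequence of normal subgroups of `H`. -/
def completion (N : ℕ → Subgroup H) [∀ k, (N k).Normal] (hN : Antitone N) :
    Subgroup (∀ k, H ⧸ N k) where
  carrier := {x | ∀ k l (h : k ≤ l),
    QuotientGroup.map (N l) (N k) (MonoidHom.id H) (hN h) (x l) = x k}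
  one_mem' := fun _ _ _ => map_one _
  mul_mem' := by
    intro x y hx hy k l h
    simp only [Pi.mul_apply, map_mul, hx k l h, hy k l h]
  inv_mem' := by
    intro x hx k l h
    simp only [Pi.inv_apply, map_inv, hx k l h]

/-- The natural homomorphism between the completions, for `N k ≤ M k`, induced by the projections
`H ⧸ N k → H ⧸ M k`. -/
def completionMap {N M : ℕ → Subgroup H} [∀ k, (N k).Normal] [∀ k, (M k).Normal]
    (hN : Antitone N) (hM : Antitone M) (h : ∀ k, N k ≤ M k) :
    completion N hN →* completion M hM where
  toFun x := ⟨fun k => QuotientGroup.map (N k) (M k) (MonoidHom.id H) (h k) (x.1 k), by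
    intro k l hkl
    have hx := x.2 k l hkl
    obtain ⟨g, hg⟩ := QuotientGroup.mk_surjective (x.1 l)
    rw [← hg] at hx
    change QuotientGroup.map (M l) (M k) (MonoidHom.id H) (hM hkl)
      (QuotientGroup.map (N l) (M l) (MonoidHom.id H) (h l) (x.1 l)) =
        QuotientGroup.map (N k) (M k) (MonoidHom.id H) (h k) (x.1 k)
    rw [← hx, ← hg]
    rfl⟩
  map_one' := Subtype.ext (funext fun _ => map_one _)
  map_mul' _ _ := Subtype.ext (funext fun _ => map_mul _ _ _)

end completion

/-- The branch completion, the inverse limit of the `G ⧸ Rist_G(k)`. (Level `0` contributes only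
the trivial quotient, here and below.) -/
abbrev branchCompletion (G : Subgroup (treeAut d)) : Subgroup (∀ k, G ⧸ levelRist G k) :=
  completion (levelRist G) (levelRist_antitone G)

/-- The congruence completion, the inverse limit of the `G ⧸ St_G(k)`. -/
abbrev congruenceCompletion (G : Subgroup (treeAut d)) : Subgroup (∀ k, G ⧸ levelStab G k) :=
  completion (levelStab G) (levelStab_antitone G)

/-- The rigid kernel of `G`: the kernel of the natural homomorphism from the branch completion to
the congruence completion. -/
def rigidKernel (G : Subgroup (treeAut d)) : Subgroup (branchCompletion G) :=
  (completionMap (levelRist_antitone G) (levelStab_antitone G)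
    (levelRist_le_levelStab G)).ker

end RigidKernel

namespace RigidKernel

variable {d : ℕ}

/-! ### The cyclic successor -/

/-! Everything rests on the exponent sum ε : G_d → ℤ that sends each generator to 1. It is well
defined (`expSum_eq_zero`). Every generator has exactly two nontrivial first-level sections, both
generators, so the exponents of the sections of g add up to 2 ε(g).

Since d is odd, steps of length two reach every letter of the cycle. This makes G_d self-replicating
and yields enough elements supported on one subtree: if 4 ∣ ε(h), then `delta x h`, acting as h
below x, lies in G_d and has exponent ε(h)/2 (`HasExp.delta`). Induction on the level, with
divisibility by powers of two carried along, shows that the rigid stabilizers have finite index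
(`finiteIndex_levelPart`). Conversely, for k ≥ 1 the level-k sections of an element of Rist(k) have
exponents divisible by 2^(k+1) (`exists_section_of_mem_levelRist`); this is the obstruction that
makes the rigid kernel nontrivial.

An element of the rigid kernel comes from a sequence of g_k in St(k) with g_k⁻¹ g_(k+1) in Rist(k)
(`exists_rigidKernel`). If g_k has the section a_i^2 at all words of length k in i and i+1, then the
exponent at level k stays 2 while the obstruction grows, so no positive power is trivial. If for k ≥
1 instead g_k has the section a_i^(2^k) at just two words, it misses the divisibility by one factor
2, and its square lies in Rist(k): this gives order two. -/

theorem finRotate_pow_card (hd : 3 ≤ d) : finRotate d ^ d = 1 := by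
  obtain ⟨n, rfl⟩ : ∃ n, d = n + 2 := ⟨d - 2, by omega⟩
  have h := (isCycle_finRotate (n := n)).orderOf
  rw [support_finRotate, Finset.card_univ, Fintype.card_fin] at h
  have h' := pow_orderOf_eq_one (finRotate (n + 2))
  rwa [h] at h'

theorem finRotate_ne_self (hd : 3 ≤ d) (i : Fin d) : finRotate d i ≠ i := by
  obtain ⟨n, rfl⟩ : ∃ n, d = n + 3 := ⟨d - 3, by omega⟩
  simp

theorem finRotate_finRotate_ne_self (hd : 3 ≤ d) (i : Fin d) :
    finRotate d (finRotate d i) ≠ i := by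
  obtain ⟨n, rfl⟩ : ∃ n, d = n + 3 := ⟨d - 3, by omega⟩
  simp only [finRotate_apply, add_assoc, ne_eq, add_eq_left]
  intro h
  have := congrArg Fin.val h
  simp [Fin.val_add] at this
  rw [Nat.mod_eq_of_lt (by omega)] at this
  omega

/-- In an odd cycle, every vertex is reached from any other one by steps of length two. -/
theorem two_step_induction (hd : 3 ≤ d) (hodd : Odd d) {p : Fin d → Prop} (x : Fin d) (hx : p x)
    (hp : ∀ y, p y → p (finRotate d (finRotate d y))) (y : Fin d) : p y := by
  have h2 : ∀ (k : ℕ) (z : Fin d), p z → p ((finRotate d ^ (2 * k)) z) := by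
    intro k
    induction k with
    | zero => intro z hz; simpa using hz
    | succ k ih =>
      intro z hz
      have := hp _ (ih z hz)
      rw [show 2 * (k + 1) = 1 + (1 + 2 * k) by ring, pow_add, pow_add]
      simpa using this
  -- A single step equals d + 1 steps around the cycle, an even number.
  have h1 : ∀ z, p z → p (finRotate d z) := by
    intro z hz
    obtain ⟨m, hm⟩ := hodd
    have := h2 (m + 1) z hz
    rwa [show 2 * (m + 1) = d + 1 by omega, pow_succ, finRotate_pow_card hd, one_mul] at this
  have hk : ∀ (k : ℕ), p ((finRotate d ^ k) x) := by
    intro k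
    induction k with
    | zero => simpa using hx
    | succ k ih => rw [pow_succ']; exact h1 _ ih
  obtain ⟨n, rfl⟩ : ∃ n, d = n + 2 := ⟨d - 2, by omega⟩
  have hs := (isCycle_finRotate (n := n)).sameCycle (x := x) (y := y)
    (finRotate_ne_self hd x) (finRotate_ne_self hd y)
  obtain ⟨k, -, hk'⟩ := hs.exists_pow_eq'
  rw [← hk']
  exact hk k

/-! ### Words in the generators -/

/-- A signed generator: `(i, true)` is `a_i` and `(i, false)` is its inverse. -/
abbrev Letter (d : ℕ) := Fin d × Bool

/-- The tree automorphism given by a letter. -/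
def letterAut : Letter d → treeAut d
  | (i, true) => gen i
  | (i, false) => (gen i)⁻¹

/-- The exponent of a letter. -/
def letterExp (l : Letter d) : ℤ := if l.2 then 1 else -1

/-- The section of a letter at a vertex of the first level, as a word of length at most one. -/
def secLetter : Letter d → Fin d → List (Letter d)
  | (i, true), x =>
    if x = i then [(i, true)] else if x = finRotate d i then [(finRotate d i, true)] else []
  | (i, false), x =>
    if x = finRotate d i then [(i, false)] else if x = i then [(finRotate d i, false)] else []

/-- The action of a letter on the first level. -/
def letterPerm (l : Letter d) : Equiv.Perm (Fin d) := Equiv.swap l.1 (finRotate d l.1)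

/-- The tree automorphism given by a word, the first letter of which acts first. -/
def eval : List (Letter d) → treeAut d
  | [] => 1
  | l :: w => eval w * letterAut l

/-- The sum of the exponents of a word. -/
def expSum : List (Letter d) → ℤ
  | [] => 0
  | l :: w => letterExp l + expSum w

/-- The section of a word at a vertex of the first level. -/
def secWord : List (Letter d) → Fin d → List (Letter d)
  | [], _ => []
  | l :: w, x => secLetter l x ++ secWord w (letterPerm l x)

/-- The action of a word on the first level. -/
def rootPerm : List (Letter d) → Equiv.Perm (Fin d)
  | [] => 1
  | l :: w => rootPerm w * letterPerm l

theorem eval_append (v w : List (Letter d)) : eval (v ++ w) = eval w * eval v := by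
  induction v with
  | nil => simp [eval]
  | cons l v ih => simp [eval, ih, mul_assoc]

theorem expSum_append (v w : List (Letter d)) : expSum (v ++ w) = expSum v + expSum w := by
  induction v with
  | nil => simp [expSum]
  | cons l v ih => simp [expSum, ih, add_assoc]

theorem natAbs_expSum_le (w : List (Letter d)) : (expSum w).natAbs ≤ w.length := by
  induction w with
  | nil => simp [expSum]
  | cons l w ih =>
    have : (letterExp l).natAbs = 1 := by unfold letterExp; split_ifs <;> rfl
    simp only [expSum, List.length_cons]
    omega

theorem eval_singleton (l : Letter d) : eval [l] = letterAut l := by simp [eval]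

theorem letterAut_cons (hd : 3 ≤ d) (l : Letter d) (x : Fin d) (u : List (Fin d)) :
    (letterAut l).1 (x :: u) = letterPerm l x :: (eval (secLetter l x)).1 u := by
  have hne := finRotate_ne_self hd l.1
  rcases l with ⟨i, _ | _⟩
  · change genInv i (x :: u) = _
    rw [genInv]
    by_cases h : x = finRotate d i
    · subst h
      simp [letterPerm, secLetter, eval_singleton]; rfl
    · by_cases h' : x = i
      · subst h'
        simp only [h, if_false, if_true, letterPerm, secLetter, eval_singleton,
          Equiv.swap_apply_left]; rfl
      · simp [-finRotate_apply, h, h', letterPerm, secLetter, eval, Equiv.swap_apply_of_ne_of_ne]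
  · change genFun i (x :: u) = _
    rw [genFun]
    by_cases h' : x = i
    · subst h'
      simp [letterPerm, secLetter, eval_singleton]; rfl
    · by_cases h : x = finRotate d i
      · subst h
        simp only [h', if_false, if_true, letterPerm, secLetter, eval_singleton,
          Equiv.swap_apply_right]; rfl
      · simp [-finRotate_apply, h, h', letterPerm, secLetter, eval, Equiv.swap_apply_of_ne_of_ne]

theorem eval_cons (hd : 3 ≤ d) (w : List (Letter d)) (x : Fin d) (u : List (Fin d)) :
    (eval w).1 (x :: u) = rootPerm w x :: (eval (secWord w x)).1 u := by
  induction w generalizing x u with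
  | nil => rfl
  | cons l w ih =>
    change (eval w).1 ((letterAut l).1 (x :: u)) = _
    rw [letterAut_cons hd, ih, secWord, eval_append]
    rfl

theorem sum_secLetter {M : Type*} [AddCommMonoid M] (hd : 3 ≤ d) (f : List (Letter d) → M)
    (h0 : f [] = 0) (l : Letter d) :
    ∑ x, f (secLetter l x) = f [(l.1, l.2)] + f [(finRotate d l.1, l.2)] := by
  have hne := finRotate_ne_self hd l.1
  have h : ∀ x, x ≠ l.1 ∧ x ≠ finRotate d l.1 → f (secLetter l x) = 0 := by
    rintro x ⟨h1, h2⟩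
    rcases l with ⟨i, _ | _⟩ <;> simp_all [secLetter]
  rw [Fintype.sum_eq_add _ _ hne.symm h]
  rcases l with ⟨i, _ | _⟩
  · simp only [secLetter, if_true, if_neg hne.symm]
    exact add_comm _ _
  · simp only [secLetter, if_true, if_neg hne]

/-- Each letter contributes one letter of its own sign to exactly two sections; permuting the first
level only reindexes the sum. -/
theorem sum_expSum_secWord (hd : 3 ≤ d) (w : List (Letter d)) :
    ∑ x, expSum (secWord w x) = 2 * expSum w := by
  induction w with
  | nil => simp [secWord, expSum]
  | cons l w ih =>
    simp only [secWord, expSum_append, Finset.sum_add_distrib]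
    rw [Equiv.sum_comp (letterPerm l) (fun x => expSum (secWord w x)), ih,
      sum_secLetter hd _ rfl]
    simp only [expSum, letterExp]
    ring

theorem sum_length_secWord (hd : 3 ≤ d) (w : List (Letter d)) :
    ∑ x, (secWord w x).length = 2 * w.length := by
  induction w with
  | nil => simp [secWord]
  | cons l w ih =>
    simp only [secWord, List.length_append, Finset.sum_add_distrib]
    rw [Equiv.sum_comp (letterPerm l) (fun x => (secWord w x).length), ih,
      sum_secLetter hd _ rfl]
    simp only [List.length_cons, List.length_nil]
    ring

theorem length_secLetter_le (l : Letter d) (x : Fin d) : (secLetter l x).length ≤ 1 := by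
  rcases l with ⟨i, _ | _⟩ <;> simp only [secLetter] <;> split_ifs <;> simp

theorem eq_or_eq_of_length_secLetter {l : Letter d} {x : Fin d}
    (h : (secLetter l x).length = 1) : x = l.1 ∨ x = finRotate d l.1 := by
  by_contra! hx
  rcases l with ⟨i, _ | _⟩ <;> simp_all [secLetter]

theorem length_secWord_le (w : List (Letter d)) (x : Fin d) :
    (secWord w x).length ≤ w.length := by
  induction w generalizing x with
  | nil => simp [secWord]
  | cons l w ih =>
    have h1 := length_secLetter_le l x
    have h2 := ih (letterPerm l x)
    simp only [secWord, List.length_append, List.length_cons]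
    omega

theorem sign_rootPerm (hd : 3 ≤ d) (w : List (Letter d)) :
    Equiv.Perm.sign (rootPerm w) = (-1) ^ expSum w := by
  induction w with
  | nil => simp [rootPerm, expSum]
  | cons l w ih =>
    have h : Equiv.Perm.sign (letterPerm l) = (-1) ^ letterExp l := by
      rw [letterPerm, Equiv.Perm.sign_swap (finRotate_ne_self hd l.1).symm, letterExp]
      split_ifs <;> simp
    rw [rootPerm, map_mul, ih, h, expSum, zpow_add, mul_comm]

theorem eval_secWord_eq_one (hd : 3 ≤ d) {w : List (Letter d)} (h : eval w = 1) (x : Fin d) :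
    eval (secWord w x) = 1 := by
  refine Subtype.ext (Equiv.ext fun u => ?_)
  have h1 := eval_cons hd w x u
  rw [h] at h1
  exact (List.cons.inj h1).2.symm

theorem rootPerm_eq_one (hd : 3 ≤ d) {w : List (Letter d)} (h : eval w = 1) : rootPerm w = 1 := by
  ext x : 1
  have h1 := eval_cons hd w x []
  rw [h] at h1
  exact (List.cons.inj h1).1.symm

theorem even_of_sign (n : ℤ) (h : ((-1 : ℤˣ)) ^ n = 1) : Even n := by
  by_contra hn
  rw [Int.not_even_iff_odd] at hn
  rw [Odd.neg_one_zpow hn] at h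
  exact absurd h (by decide)

/-- A word that is long at two vertices of the first level begins with two letters of the same
index. -/
theorem index_eq_of_length_secWord (hd : 3 ≤ d) {l l' : Letter d} {w : List (Letter d)}
    {x y : Fin d} (hxy : x ≠ y)
    (hx : (secWord (l :: l' :: w) x).length = (l :: l' :: w).length)
    (hy : (secWord (l :: l' :: w) y).length = (l :: l' :: w).length) : l.1 = l'.1 := by
  have key : ∀ z, (secWord (l :: l' :: w) z).length = (l :: l' :: w).length →
      (z = l.1 ∨ z = finRotate d l.1) ∧
        (letterPerm l z = l'.1 ∨ letterPerm l z = finRotate d l'.1) := by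
    intro z hz
    simp only [secWord, List.length_append, List.length_cons] at hz
    have h1 := length_secLetter_le l z
    have h2 := length_secLetter_le l' (letterPerm l z)
    have h3 := length_secWord_le w (letterPerm l' (letterPerm l z))
    exact ⟨eq_or_eq_of_length_secLetter (by omega), eq_or_eq_of_length_secLetter (by omega)⟩
  obtain ⟨h1, h2⟩ := key x hx
  obtain ⟨h3, h4⟩ := key y hy
  -- Two edges of a cycle with at least three vertices that have the same endpoints coincide. The
  -- letter `l` exchanges its endpoints `x` and `y`, and both images must lie on the edge of `l'`.
  have key2 : ∀ i j : Fin d, (i = j ∨ i = finRotate d j) →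
      (finRotate d i = j ∨ finRotate d i = finRotate d j) → i = j := by
    intro i j h h'
    rcases h with h | h
    · exact h
    · rcases h' with h' | h'
      · rw [h] at h'
        exact absurd h' (finRotate_finRotate_ne_self hd j)
      · exact (finRotate d).injective h'
  simp only [letterPerm] at h2 h4
  rcases h1 with rfl | rfl <;> rcases h3 with rfl | rfl
  · exact absurd rfl hxy
  · rw [Equiv.swap_apply_left] at h2
    rw [Equiv.swap_apply_right] at h4
    exact key2 _ _ h4 h2
  · rw [Equiv.swap_apply_left] at h4
    rw [Equiv.swap_apply_right] at h2
    exact key2 _ _ h2 h4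
  · exact absurd rfl hxy

/-- A word that represents the identity has exponent sum `0`. -/
theorem expSum_eq_zero (hd : 3 ≤ d) (w : List (Letter d)) (hw : eval w = 1) : expSum w = 0 := by
  induction hn : w.length using Nat.strong_induction_on generalizing w with
  | _ n ih =>
  by_contra h0
  -- Choose a word of length `n` whose exponent sum has maximal absolute value.
  let S : Set ℕ := {m | ∃ v : List (Letter d), eval v = 1 ∧ v.length = n ∧ (expSum v).natAbs = m}
  have hSb : BddAbove S := ⟨n, by
    rintro m ⟨v, -, hv, rfl⟩
    exact hv ▸ natAbs_expSum_le v⟩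
  have hSn : S.Nonempty := ⟨_, w, hw, hn, rfl⟩
  set m := sSup S
  have hmS : m ∈ S := Nat.sSup_mem hSn hSb
  have hmax : ∀ v : List (Letter d), eval v = 1 → v.length = n → (expSum v).natAbs ≤ m :=
    fun v h1 h2 => le_csSup hSb ⟨v, h1, h2, rfl⟩
  have hm0 : 0 < m := lt_of_lt_of_le (Int.natAbs_pos.2 h0) (hmax w hw hn)
  -- A maximal word has two long sections, and these are maximal again.
  have step : ∀ v : List (Letter d), eval v = 1 → v.length = n → (expSum v).natAbs = m →
      ∃ x y, x ≠ y ∧ (secWord v x).length = n ∧ (secWord v y).length = n ∧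
        (expSum (secWord v x)).natAbs = m := by
    intro v hv hvn hvm
    have hsum := sum_expSum_secWord hd v
    have hlen := sum_length_secWord hd v
    have hne : ∃ x, expSum (secWord v x) ≠ 0 := by
      by_contra! h
      simp only [h, Finset.sum_const_zero] at hsum
      omega
    obtain ⟨x, hx⟩ := hne
    -- All sections represent the identity, so the shorter ones have exponent sum 0 by induction.
    have hlong : ∀ z, expSum (secWord v z) ≠ 0 → (secWord v z).length = n := by
      intro z hz
      have h1 := length_secWord_le v z
      by_contra h2
      exact hz (ih _ (by omega) _ (eval_secWord_eq_one hd hv z) rfl)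
    have hxm := hmax _ (eval_secWord_eq_one hd hv x) (hlong x hx)
    have hne2 : ∃ y, y ≠ x ∧ expSum (secWord v y) ≠ 0 := by
      by_contra! h
      rw [Fintype.sum_eq_single x h] at hsum
      omega
    obtain ⟨y, hyx, hy⟩ := hne2
    have hym := hmax _ (eval_secWord_eq_one hd hv y) (hlong y hy)
    have hz : ∀ z, z ≠ x ∧ z ≠ y → expSum (secWord v z) = 0 := by
      rintro z ⟨hzx, hzy⟩
      by_contra hz
      -- Three sections of length `n` would exceed the total length `2 * n`, as `n` is at least `m`
      -- and hence positive. So two sections, each of absolute exponent at most `m`, share a total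
      -- of `±2 * m`.
      have h3 : ∑ t ∈ {x, y, z}, (secWord v t).length ≤ ∑ t, (secWord v t).length :=
        Finset.sum_le_sum_of_subset (Finset.subset_univ _)
      rw [Finset.sum_insert (by simp [hyx.symm, hzx.symm]), Finset.sum_pair hzy.symm, hlen,
        hlong x hx, hlong y hy, hlong z hz] at h3
      have := natAbs_expSum_le v
      omega
    rw [Fintype.sum_eq_add x y hyx.symm hz] at hsum
    exact ⟨x, y, hyx.symm, hlong x hx, hlong y hy, by omega⟩
  -- A maximal word begins with the same letter twice.
  have start : ∀ v : List (Letter d), eval v = 1 → v.length = n → (expSum v).natAbs = m →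
      ∃ l v', v = l :: l :: v' := by
    intro v hv hvn hvm
    obtain ⟨x, y, hxy, hx, hy, -⟩ := step v hv hvn hvm
    -- Parity rules out words of length one.
    have hev : Even (expSum v) := even_of_sign _ (by
      rw [← sign_rootPerm hd, rootPerm_eq_one hd hv, map_one])
    have hb := natAbs_expSum_le v
    match v, hv, hvn, hvm, hx, hy, hev, hb with
    | [], _, _, hvm, _, _, _, _ => simp only [expSum, Int.natAbs_zero] at hvm; omega
    | [_], _, _, hvm, _, _, ⟨r, hr⟩, hb =>
      simp only [List.length_cons, List.length_nil] at hb
      omega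
    | (i, b) :: (j, c) :: v', hv, hvn, hvm, hx, hy, _, _ =>
      have hij : i = j := index_eq_of_length_secWord hd hxy (hx.trans hvn.symm) (hy.trans hvn.symm)
      subst hij
      by_cases hbc : b = c
      · subst hbc
        exact ⟨_, _, rfl⟩
      -- Inverse letters cancel, leaving a shorter word with the same exponent sum, against the
      -- induction hypothesis.
      · exfalso
        have e1 : eval v' = 1 := by
          rw [← hv]
          cases b <;> cases c <;> simp_all [eval, letterAut]
        have e2 : expSum v' = expSum ((i, b) :: (i, c) :: v') := by
          cases b <;> cases c <;> simp_all [expSum, letterExp]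
        simp only [List.length_cons] at hvn
        have := ih v'.length (by omega) v' e1 rfl
        omega
  -- A maximal word starts with a repeated letter of index `i`, and so does its maximal section at
  -- `x`. But that letter moves `x` to the other endpoint of its edge, so this section starts with
  -- the indices of the two endpoints, which differ.
  obtain ⟨v, hv, hvn, hvm⟩ := hmS
  obtain ⟨x, y, hxy, hx, -, hxm⟩ := step v hv hvn hvm
  obtain ⟨l, v', rfl⟩ := start v hv hvn hvm
  obtain ⟨l', v'', h⟩ := start _ (eval_secWord_eq_one hd hv x) hx hxm
  have hne := finRotate_ne_self hd l.1
  have hlx : x = l.1 ∨ x = finRotate d l.1 := by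
    apply eq_or_eq_of_length_secLetter
    have h1 := length_secLetter_le l x
    have h2 := length_secWord_le (l :: v') (letterPerm l x)
    simp only [secWord, List.length_append, List.length_cons] at h2 hx hvn
    omega
  rcases l with ⟨i, _ | _⟩ <;> simp only at hlx hne <;> rcases hlx with rfl | rfl <;>
    simp [-finRotate_apply, secWord, secLetter, letterPerm, hne, hne.symm] at h <;>
    obtain ⟨rfl, h, -⟩ := h <;> simp [-finRotate_apply, hne, hne.symm] at h

/-! ### The exponent sum of an element of the group -/

/-- `g` is represented by a word of exponent sum `n`. -/
def HasExp (g : treeAut d) (n : ℤ) : Prop := ∃ w : List (Letter d), eval w = g ∧ expSum w = n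

theorem HasExp.one : HasExp (1 : treeAut d) 0 := ⟨[], rfl, rfl⟩

theorem HasExp.mul {g h : treeAut d} {m n : ℤ} (hg : HasExp g m) (hh : HasExp h n) :
    HasExp (g * h) (m + n) := by
  obtain ⟨v, rfl, rfl⟩ := hg
  obtain ⟨w, rfl, rfl⟩ := hh
  exact ⟨w ++ v, eval_append w v, by rw [expSum_append, add_comm]⟩

theorem HasExp.gen (i : Fin d) : HasExp (gen i) 1 :=
  ⟨[(i, true)], eval_singleton _, rfl⟩

theorem HasExp.gen_inv (i : Fin d) : HasExp (RigidKernel.gen i)⁻¹ (-1) :=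
  ⟨[(i, false)], eval_singleton _, rfl⟩

theorem HasExp.inv {g : treeAut d} {n : ℤ} (hg : HasExp g n) : HasExp g⁻¹ (-n) := by
  obtain ⟨w, rfl, rfl⟩ := hg
  induction w with
  | nil => simpa [eval, expSum] using HasExp.one
  | cons l w ih =>
    have hl : HasExp (letterAut l)⁻¹ (-letterExp l) := by
      rcases l with ⟨i, _ | _⟩
      · simpa [letterAut, letterExp] using HasExp.gen i
      · simpa [letterAut, letterExp] using HasExp.gen_inv i
    have := hl.mul ih
    rwa [← mul_inv_rev, ← neg_add] at this

theorem HasExp.pow {g : treeAut d} {n : ℤ} (hg : HasExp g n) (k : ℕ) :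
    HasExp (g ^ k) (k * n) := by
  induction k with
  | zero => simpa using HasExp.one
  | succ k ih =>
    rw [pow_succ]
    convert ih.mul hg using 1
    push_cast
    ring

/-- Comparing two words for `g` gives a word for 1, so the exponent is a homomorphism from the group
to ℤ. -/
theorem HasExp.unique (hd : 3 ≤ d) {g : treeAut d} {m n : ℤ} (hm : HasExp g m)
    (hn : HasExp g n) : m = n := by
  obtain ⟨w, hw, hw'⟩ := hm.mul hn.inv
  rw [mul_inv_cancel] at hw
  have := expSum_eq_zero hd w hw
  omega

theorem mem_groupG_iff {g : treeAut d} : g ∈ groupG d ↔ ∃ n, HasExp g n := by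
  constructor
  · intro hg
    induction hg using Subgroup.closure_induction with
    | mem g hg =>
      obtain ⟨i, rfl⟩ := hg
      exact ⟨_, HasExp.gen i⟩
    | one => exact ⟨_, HasExp.one⟩
    | mul a b _ _ ha hb => exact ⟨_, ha.choose_spec.mul hb.choose_spec⟩
    | inv a _ ha => exact ⟨_, ha.choose_spec.inv⟩
  · rintro ⟨_, w, rfl, -⟩
    induction w with
    | nil => exact one_mem _
    | cons l w ih =>
      refine mul_mem ih ?_
      rcases l with ⟨i, _ | _⟩
      · exact inv_mem (Subgroup.subset_closure ⟨i, rfl⟩)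
      · exact Subgroup.subset_closure ⟨i, rfl⟩

theorem HasExp.mem {g : treeAut d} {n : ℤ} (h : HasExp g n) : g ∈ groupG d :=
  mem_groupG_iff.2 ⟨n, h⟩

theorem gen_mem (i : Fin d) : gen i ∈ groupG d := (HasExp.gen i).mem

/-- The decomposition of an element of the group at the first level. -/
theorem HasExp.exists_sections (hd : 3 ≤ d) {g : treeAut d} {n : ℤ} (hg : HasExp g n) :
    ∃ (p : Equiv.Perm (Fin d)) (s : Fin d → treeAut d) (m : Fin d → ℤ),
      (∀ x w, g.1 (x :: w) = p x :: (s x).1 w) ∧ (∀ x, HasExp (s x) (m x)) ∧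
        ∑ x, m x = 2 * n ∧ Equiv.Perm.sign p = (-1) ^ n := by
  obtain ⟨w, rfl, rfl⟩ := hg
  exact ⟨rootPerm w, fun x => eval (secWord w x), fun x => expSum (secWord w x),
    eval_cons hd w, fun x => ⟨_, rfl, rfl⟩, sum_expSum_secWord hd w, sign_rootPerm hd w⟩

/-! ### Automorphisms with given sections -/

theorem treeAut_ext {g h : treeAut d} (H : ∀ x w, g.1 (x :: w) = h.1 (x :: w)) : g = h := by
  refine Subtype.ext (Equiv.ext fun u => ?_)
  rcases u with _ | ⟨x, u⟩
  · rw [g.2.1, h.2.1]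
  · exact H x u

/-- The action on words of the automorphism with trivial action on the first level and with
sections `s x`. -/
def wreathFun (s : Fin d → treeAut d) : List (Fin d) → List (Fin d)
  | [] => []
  | x :: w => x :: (s x).1 w

theorem wreathFun_inv (s : Fin d → treeAut d) (u : List (Fin d)) :
    wreathFun s⁻¹ (wreathFun s u) = u := by
  rcases u with _ | ⟨x, u⟩
  · rfl
  · simp [wreathFun]

theorem tree_adj_cons {x y : Fin d} {u v : List (Fin d)} :
    (tree d).Adj (x :: u) (y :: v) ↔ x = y ∧ (tree d).Adj u v := by
  simp only [tree, List.cons_append, List.cons.injEq]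
  constructor
  · rintro (⟨z, rfl, h⟩ | ⟨z, rfl, h⟩)
    · exact ⟨rfl, Or.inl ⟨z, h⟩⟩
    · exact ⟨rfl, Or.inr ⟨z, h⟩⟩
  · rintro ⟨rfl, ⟨z, h⟩ | ⟨z, h⟩⟩
    · exact Or.inl ⟨z, rfl, h⟩
    · exact Or.inr ⟨z, rfl, h⟩

theorem tree_adj_nil_cons {y : Fin d} {v : List (Fin d)} :
    (tree d).Adj [] (y :: v) ↔ v = [] := by
  simp [tree]

/-- The automorphism that fixes the first level and has the sections `s x` there. -/
def wreath : (Fin d → treeAut d) →* treeAut d where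
  toFun s := ⟨⟨wreathFun s, wreathFun s⁻¹, wreathFun_inv s, by
      intro u
      simpa using wreathFun_inv s⁻¹ u⟩, rfl, by
    have h : ∀ (g : treeAut d) (v : List (Fin d)), g.1 v = [] ↔ v = [] := fun g v => by
      rw [← List.length_eq_zero_iff, treeAut_length, List.length_eq_zero_iff]
    rintro (_ | ⟨x, u⟩) (_ | ⟨y, v⟩)
    · rfl
    · change (tree d).Adj [] (y :: (s y).1 v) ↔ _
      rw [tree_adj_nil_cons, tree_adj_nil_cons, h]
    · change (tree d).Adj (x :: (s x).1 u) [] ↔ _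
      rw [SimpleGraph.adj_comm, tree_adj_nil_cons, SimpleGraph.adj_comm, tree_adj_nil_cons, h]
    · change (tree d).Adj (x :: (s x).1 u) (y :: (s y).1 v) ↔ _
      rw [tree_adj_cons, tree_adj_cons]
      refine and_congr_right ?_
      rintro rfl
      exact (s x).2.2 u v⟩
  map_one' := treeAut_ext fun _ _ => rfl
  map_mul' _ _ := treeAut_ext fun _ _ => rfl

theorem wreath_cons (s : Fin d → treeAut d) (x : Fin d) (w : List (Fin d)) :
    (wreath s).1 (x :: w) = x :: (s x).1 w := rfl

/-- The automorphism acting as `h` on the subtree at the vertex `x` of the first level, and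
trivially outside of it. -/
def delta (x : Fin d) : treeAut d →* treeAut d :=
  wreath.comp (MonoidHom.mulSingle (fun _ => treeAut d) x)

theorem delta_cons_self (x : Fin d) (h : treeAut d) (w : List (Fin d)) :
    (delta x h).1 (x :: w) = x :: h.1 w := by
  change x :: (Pi.mulSingle (M := fun _ => treeAut d) x h x).1 w = _
  rw [Pi.mulSingle_eq_same]

theorem delta_cons_of_ne {x y : Fin d} (hxy : y ≠ x) (h : treeAut d) (w : List (Fin d)) :
    (delta x h).1 (y :: w) = y :: w := by
  change y :: (Pi.mulSingle (M := fun _ => treeAut d) x h y).1 w = _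
  rw [Pi.mulSingle_eq_of_ne hxy]
  rfl

theorem wreath_mem {K : Subgroup (treeAut d)} {s : Fin d → treeAut d}
    (h : ∀ x, delta x (s x) ∈ K) : wreath s ∈ K :=
  Subgroup.mem_comap.1 (Subgroup.pi_mem_of_mulSingle_mem s (H := K.comap wreath) h)

/-- Away from `x` the sections are trivial and have exponent 0 by uniqueness, so the doubling
formula has a single term. -/
theorem exists_delta_exp (hd : 3 ≤ d) {x : Fin d} {h : treeAut d} {m : ℤ} (hm : HasExp h m)
    (hG : delta x h ∈ groupG d) : ∃ n, m = 2 * n ∧ HasExp (delta x h) n := by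
  obtain ⟨n, hn⟩ := mem_groupG_iff.1 hG
  refine ⟨n, ?_, hn⟩
  obtain ⟨p, s, k, hs, hk, hsum, -⟩ := hn.exists_sections hd
  have h1 : ∀ y, y ≠ x → k y = 0 := by
    intro y hy
    have : s y = 1 := by
      refine Subtype.ext (Equiv.ext fun w => ?_)
      have := hs y w
      rw [delta_cons_of_ne hy] at this
      exact (List.cons.inj this).2.symm
    have h2 := hk y
    rw [this] at h2
    exact h2.unique hd HasExp.one
  have h2 : s x = h := by
    refine Subtype.ext (Equiv.ext fun w => ?_)
    have := hs x w
    rw [delta_cons_self] at this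
    exact (List.cons.inj this).2.symm
  have hkx : k x = m := (h2 ▸ hk x).unique hd hm
  rw [Fintype.sum_eq_single x h1, hkx] at hsum
  exact hsum

/-! ### Self-replication -/

/-- Some element of the group maps the vertex `x` of the first level to `y`, with section `g`. -/
def Connects (x : Fin d) (g : treeAut d) (y : Fin d) : Prop :=
  ∃ f ∈ groupG d, ∀ w, f.1 (x :: w) = y :: g.1 w

theorem Connects.refl (x : Fin d) : Connects x 1 x := ⟨1, one_mem _, fun _ => rfl⟩

theorem Connects.trans {x y z : Fin d} {g h : treeAut d} (hg : Connects x g y)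
    (hh : Connects y h z) : Connects x (h * g) z := by
  obtain ⟨f, hf, hf'⟩ := hg
  obtain ⟨k, hk, hk'⟩ := hh
  refine ⟨k * f, mul_mem hk hf, fun w => ?_⟩
  change k.1 (f.1 (x :: w)) = _
  rw [hf', hk']
  rfl

theorem Connects.symm {x y : Fin d} {g : treeAut d} (hg : Connects x g y) :
    Connects y g⁻¹ x := by
  obtain ⟨f, hf, hf'⟩ := hg
  refine ⟨f⁻¹, inv_mem hf, fun w => ?_⟩
  change (f.1)⁻¹ _ = _
  rw [Equiv.Perm.inv_eq_iff_eq, hf']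
  simp

theorem gen_cons_self (i : Fin d) (w : List (Fin d)) :
    (gen i).1 (i :: w) = finRotate d i :: (gen i).1 w := by
  change genFun i (i :: w) = _
  rw [genFun, if_pos rfl]
  rfl

theorem gen_cons_rotate (hd : 3 ≤ d) (i : Fin d) (w : List (Fin d)) :
    (gen i).1 (finRotate d i :: w) = i :: (gen (finRotate d i)).1 w := by
  change genFun i (_ :: w) = _
  rw [genFun, if_neg (finRotate_ne_self hd i), if_pos rfl]
  rfl

theorem gen_cons_of_ne {i x : Fin d} (h : x ≠ i) (h' : x ≠ finRotate d i) (w : List (Fin d)) :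
    (gen i).1 (x :: w) = x :: w := by
  change genFun i (x :: w) = _
  rw [genFun, if_neg h, if_neg h']

/-- From z+1, `a_z` leads to z and `a_(z+1)` leads to z+2, both with section `a_(z+1)`. The sections
cancel on the way from z to z+2, and d is odd. -/
theorem connects_one (hd : 3 ≤ d) (hodd : Odd d) (x y : Fin d) : Connects x 1 y := by
  refine two_step_induction hd hodd x (Connects.refl x) (fun z hz => ?_) y
  have h1 : Connects (finRotate d z) (gen (finRotate d z)) z :=
    ⟨_, gen_mem z, gen_cons_rotate hd z⟩
  have h2 : Connects (finRotate d z) (gen (finRotate d z)) (finRotate d (finRotate d z)) :=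
    ⟨_, gen_mem _, gen_cons_self _⟩
  simpa using hz.trans (h1.symm.trans h2)

theorem connects_of_mem (hd : 3 ≤ d) (hodd : Odd d) {g : treeAut d} (hg : g ∈ groupG d)
    (x y : Fin d) : Connects x g y := by
  induction hg using Subgroup.closure_induction generalizing x y with
  | mem g hg =>
    obtain ⟨i, rfl⟩ := hg
    have h : Connects i (gen i) (finRotate d i) := ⟨_, gen_mem i, gen_cons_self i⟩
    simpa using (connects_one hd hodd x i).trans (h.trans (connects_one hd hodd _ y))
  | one => exact connects_one hd hodd x y
  | mul a b _ _ ha hb => exact (hb x y).trans (ha y y)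
  | inv a _ ha => exact (ha y x).symm

/-- The group acts transitively on every level. -/
theorem exists_apply_eq (hd : 3 ≤ d) (hodd : Odd d) (u v : List (Fin d))
    (h : u.length = v.length) : ∃ g ∈ groupG d, g.1 u = v := by
  induction u generalizing v with
  | nil =>
    rw [List.length_eq_zero_iff.1 h.symm]
    exact ⟨1, one_mem _, rfl⟩
  | cons x u ih =>
    rcases v with _ | ⟨y, v⟩
    · simp at h
    · obtain ⟨g, hg, rfl⟩ := ih v (by simpa using h)
      obtain ⟨f, hf, hf'⟩ := connects_of_mem hd hodd hg x y
      exact ⟨f, hf, hf' u⟩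

/-! ### Elements supported on one subtree of the first level -/

/-- Conjugation by the connecting element carries the support from the subtree at `x` to the one at
`y`. -/
theorem Connects.delta_mem {x y : Fin d} {g h : treeAut d} (hg : Connects x g y)
    (hh : delta x h ∈ groupG d) : delta y (g * h * g⁻¹) ∈ groupG d := by
  obtain ⟨f, hf, hf'⟩ := hg
  have : delta y (g * h * g⁻¹) = f * delta x h * f⁻¹ := by
    rw [eq_mul_inv_iff_mul_eq]
    refine treeAut_ext fun z w => ?_
    change (delta y (g * h * g⁻¹)).1 (f.1 (z :: w)) = f.1 ((delta x h).1 (z :: w))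
    by_cases hz : z = x
    · subst hz
      rw [hf', delta_cons_self, delta_cons_self, hf']
      simp
    · rw [delta_cons_of_ne hz]
      have hl := treeAut_length f (z :: w)
      rcases hfz : f.1 (z :: w) with _ | ⟨z', w'⟩
      · simp [hfz] at hl
      · refine delta_cons_of_ne ?_ _ _
        rintro rfl
        refine hz ?_
        have h1 := hf' (g.1⁻¹ w')
        have h2 : g.1 (g.1⁻¹ w') = w' := by simp
        rw [h2, ← hfz] at h1
        exact (List.cons.inj (f.1.injective h1)).1.symm
  rw [this]
  exact mul_mem (mul_mem hf hh) (inv_mem hf)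

/-- The elements that the group contains as elements supported on a subtree of the first level. -/
def rigidPart (hd : 3 ≤ d) : Subgroup (treeAut d) :=
  (groupG d).comap (delta ⟨0, by omega⟩)

theorem mem_rigidPart_iff (hd : 3 ≤ d) (hodd : Odd d) {h : treeAut d} (x : Fin d) :
    h ∈ rigidPart hd ↔ delta x h ∈ groupG d := by
  constructor
  · intro hh
    simpa using (connects_one hd hodd _ x).delta_mem (Subgroup.mem_comap.1 hh)
  · intro hh
    have := (connects_one hd hodd x ⟨0, by omega⟩).delta_mem hh
    rw [one_mul, inv_one, mul_one] at this
    exact Subgroup.mem_comap.2 this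

theorem conj_mem_rigidPart (hd : 3 ≤ d) (hodd : Odd d) {g h : treeAut d} (hg : g ∈ groupG d)
    (hh : h ∈ rigidPart hd) : g * h * g⁻¹ ∈ rigidPart hd :=
  (connects_of_mem hd hodd hg ⟨0, by omega⟩ ⟨0, by omega⟩).delta_mem (Subgroup.mem_comap.1 hh)

/-- The braid commutation of two consecutive generators fails only at one vertex. -/
theorem delta_braid (hd : 3 ≤ d) (i : Fin d) :
    gen (finRotate d i) * gen i * gen (finRotate d i) *
      delta (finRotate d i) ((gen (finRotate d (finRotate d i)) * gen (finRotate d i))⁻¹ *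
        (gen i * gen (finRotate d i))) =
      gen i * gen (finRotate d i) * gen i := by
  have h1 := finRotate_ne_self hd i
  have h2 := finRotate_ne_self hd (finRotate d i)
  have h3 := finRotate_finRotate_ne_self hd i
  set j := finRotate d i with hj
  set k := finRotate d j with hk
  have ei : ∀ w, (gen i).1 (i :: w) = j :: (gen i).1 w := gen_cons_self i
  have ej : ∀ w, (gen j).1 (j :: w) = k :: (gen j).1 w := gen_cons_self j
  have ei' : ∀ w, (gen i).1 (j :: w) = i :: (gen j).1 w := gen_cons_rotate hd i
  have ej' : ∀ w, (gen j).1 (k :: w) = j :: (gen k).1 w := gen_cons_rotate hd j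
  have eik : ∀ w, (gen i).1 (k :: w) = k :: w := gen_cons_of_ne h3 h2
  have eji : ∀ w, (gen j).1 (i :: w) = i :: w := gen_cons_of_ne h1.symm h3.symm
  refine treeAut_ext fun x w => ?_
  simp only [Subgroup.coe_mul, Equiv.Perm.mul_apply]
  by_cases hxj : x = j
  · subst hxj
    rw [delta_cons_self, ei', eji, ei, ej, eik, ej']
    simp
  rw [delta_cons_of_ne hxj]
  by_cases hxi : x = i
  · subst hxi
    rw [eji, ei, ej, eik]
  by_cases hxk : x = k
  · subst hxk
    rw [ej', ei', eji, eik, ej', ei']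
  rw [gen_cons_of_ne hxj hxk, gen_cons_of_ne hxi hxj, gen_cons_of_ne hxj hxk, gen_cons_of_ne hxi hxj]

/-- The defect in `delta_braid` is conjugate to `a_y a_(y+2)⁻¹`; steps of length two then compare
any two generators. -/
theorem gen_mul_gen_inv_mem_rigidPart (hd : 3 ≤ d) (hodd : Odd d) (i j : Fin d) :
    gen i * (gen j)⁻¹ ∈ rigidPart hd := by
  refine two_step_induction hd hodd (p := fun i => gen i * (gen j)⁻¹ ∈ rigidPart hd) j
    (by rw [mul_inv_cancel]; exact one_mem _) (fun y hy => ?_) i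
  set z := finRotate d y with hz
  have h : (gen (finRotate d z) * gen z)⁻¹ * (gen y * gen z) ∈ rigidPart hd := by
    rw [mem_rigidPart_iff hd hodd z, hz,
      eq_inv_mul_of_mul_eq (delta_braid hd y)]
    exact mul_mem (inv_mem (mul_mem (mul_mem (gen_mem _) (gen_mem _)) (gen_mem _)))
      (mul_mem (mul_mem (gen_mem _) (gen_mem _)) (gen_mem _))
  have h' := conj_mem_rigidPart hd hodd (mul_mem (gen_mem (finRotate d z)) (gen_mem z)) h
  have e : gen (finRotate d z) * (gen j)⁻¹ =
      (gen (finRotate d z) * gen z * ((gen (finRotate d z) * gen z)⁻¹ * (gen y * gen z)) *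
        (gen (finRotate d z) * gen z)⁻¹)⁻¹ * (gen y * (gen j)⁻¹) := by group
  change gen (finRotate d z) * (gen j)⁻¹ ∈ _
  rw [e]
  exact mul_mem (inv_mem h') hy

/-- The rigid part is normalized by the group, and modulo it all generators agree; so `h` agrees
there with a power of `a_i`, and only its exponent matters. -/
theorem HasExp.mul_zpow_mem_rigidPart (hd : 3 ≤ d) (hodd : Odd d) (i : Fin d) {h : treeAut d}
    {n : ℤ} (hh : HasExp h n) : h * RigidKernel.gen i ^ (-n) ∈ rigidPart hd := by
  obtain ⟨w, rfl, rfl⟩ := hh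
  induction w with
  | nil => simp [eval, expSum]
  | cons l w ih =>
    have hl : letterAut l * RigidKernel.gen i ^ (-letterExp l) ∈ rigidPart hd := by
      rcases l with ⟨j, _ | _⟩
      · have h1 := gen_mul_gen_inv_mem_rigidPart hd hodd i j
        have h2 := conj_mem_rigidPart hd hodd (inv_mem (gen_mem j)) h1
        simpa [letterAut, letterExp, mul_assoc] using h2
      · simpa [letterAut, letterExp] using gen_mul_gen_inv_mem_rigidPart hd hodd j i
    have e : eval (l :: w) * RigidKernel.gen i ^ (-expSum (l :: w)) =
        eval w * RigidKernel.gen i ^ (-expSum w) * (RigidKernel.gen i ^ expSum w *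
          (letterAut l * RigidKernel.gen i ^ (-letterExp l)) *
          (RigidKernel.gen i ^ expSum w)⁻¹) := by
      simp only [eval, expSum]
      group
    rw [e]
    exact mul_mem ih (conj_mem_rigidPart hd hodd (zpow_mem (gen_mem i) _) hl)

/-- Elements of exponent sum `0` lie in the rigid part. -/
theorem HasExp.mem_rigidPart_of_zero (hd : 3 ≤ d) (hodd : Odd d) {h : treeAut d}
    (hh : HasExp h 0) : h ∈ rigidPart hd := by
  simpa using hh.mul_zpow_mem_rigidPart hd hodd ⟨0, by omega⟩

theorem gen_sq_eq (hd : 3 ≤ d) (i : Fin d) :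
    gen i ^ 2 = delta i (gen (finRotate d i) * gen i) *
      delta (finRotate d i) (gen i * gen (finRotate d i)) := by
  have hne := finRotate_ne_self hd i
  refine treeAut_ext fun x w => ?_
  rw [sq]
  simp only [Subgroup.coe_mul, Equiv.Perm.mul_apply]
  by_cases hxi : x = i
  · subst hxi
    rw [delta_cons_of_ne hne.symm, delta_cons_self, gen_cons_self, gen_cons_rotate hd]
    rfl
  by_cases hxj : x = finRotate d i
  · subst hxj
    rw [delta_cons_self, delta_cons_of_ne hne, gen_cons_rotate hd, gen_cons_self]
    rfl
  rw [delta_cons_of_ne hxj, delta_cons_of_ne hxi, gen_cons_of_ne hxi hxj, gen_cons_of_ne hxi hxj]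

theorem delta_commute {x y : Fin d} (hxy : x ≠ y) (g h : treeAut d) :
    Commute (delta x g) (delta y h) :=
  (Pi.mulSingle_commute (f := fun _ : Fin d => treeAut d) hxy g h).map wreath

/-- Elements of exponent sum `2` at two adjacent subtrees of the first level. -/
theorem delta_mul_delta_mem (hd : 3 ≤ d) (hodd : Odd d) (i : Fin d) {g h : treeAut d}
    (hg : HasExp g 2) (hh : HasExp h 2) : delta i g * delta (finRotate d i) h ∈ groupG d := by
  have hne := finRotate_ne_self hd i
  have h1 : delta i (g * (gen (finRotate d i) * gen i)⁻¹) ∈ groupG d :=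
    (mem_rigidPart_iff hd hodd i).1 (HasExp.mem_rigidPart_of_zero hd hodd (by
      simpa using hg.mul ((HasExp.gen (finRotate d i)).mul (HasExp.gen i)).inv))
  have h2 : delta (finRotate d i) ((gen i * gen (finRotate d i))⁻¹ * h) ∈ groupG d :=
    (mem_rigidPart_iff hd hodd _).1 (HasExp.mem_rigidPart_of_zero hd hodd (by
      simpa using ((HasExp.gen i).mul (HasExp.gen (finRotate d i))).inv.mul hh))
  have e : delta i g * delta (finRotate d i) h =
      delta i (g * (gen (finRotate d i) * gen i)⁻¹) * gen i ^ 2 *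
        delta (finRotate d i) ((gen i * gen (finRotate d i))⁻¹ * h) := by
    rw [gen_sq_eq hd]
    simp only [map_mul, map_inv]
    group
  rw [e]
  exact mul_mem (mul_mem h1 (pow_mem (gen_mem i) 2)) h2

/-- Dividing the elements `hq y` and `hq (y+1)` moves `a_i ^ 2` from y to y+2. As d is odd, it can
be moved from `i+1` to `i`, where the two copies in `hq i` merge into `a_i ^ 4`. -/
theorem gen_pow_four_mem_rigidPart (hd : 3 ≤ d) (hodd : Odd d) (i : Fin d) :
    gen i ^ 4 ∈ rigidPart hd := by
  have hq : ∀ y, delta y (gen i ^ 2) * delta (finRotate d y) (gen i ^ 2) ∈ groupG d := fun y =>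
    delta_mul_delta_mem hd hodd y (by simpa using (HasExp.gen i).pow 2)
      (by simpa using (HasExp.gen i).pow 2)
  have h2 : ∀ y, delta i (gen i ^ 2) * (delta y (gen i ^ 2))⁻¹ ∈ groupG d := by
    refine two_step_induction hd hodd i (by rw [mul_inv_cancel]; exact one_mem _) ?_
    intro y hy
    have h3 := mul_mem hy (hq y)
    have h4 := mul_mem h3 (inv_mem (hq (finRotate d y)))
    rw [← (delta_commute (finRotate_ne_self hd (finRotate d y)) _ _).eq] at h4
    simpa [mul_assoc] using h4
  have h3 := hq i
  rw [(delta_commute (finRotate_ne_self hd i).symm _ _).eq] at h3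
  have h5 := mul_mem (h2 (finRotate d i)) h3
  rw [mem_rigidPart_iff hd hodd i]
  rw [show 4 = 2 + 2 by norm_num, pow_add, map_mul]
  simpa [mul_assoc] using h5

/-- An element whose exponent sum is divisible by `4` occurs as an element supported on a subtree
of the first level. -/
theorem HasExp.delta (hd : 3 ≤ d) (hodd : Odd d) (x : Fin d) {h : treeAut d} {n : ℤ}
    (hh : HasExp h (4 * n)) : HasExp (RigidKernel.delta x h) (2 * n) := by
  have hG : RigidKernel.delta x h ∈ groupG d := by
    rw [← mem_rigidPart_iff hd hodd]
    have h1 := mul_mem (hh.mul_zpow_mem_rigidPart hd hodd x)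
      (zpow_mem (gen_pow_four_mem_rigidPart hd hodd x) n)
    have e : h * RigidKernel.gen x ^ (-(4 * n)) * (RigidKernel.gen x ^ 4) ^ n = h := by group
    rwa [e] at h1
  obtain ⟨m, hm, hm'⟩ := exists_delta_exp hd hh hG
  rwa [show 2 * n = m by omega]

/-! ### Rigid stabilizers with divisible exponent sums -/

/-- The subgroup generated by the elements of the group supported on one subtree of level `k`
whose exponent sum is divisible by `2 ^ j`. -/
def levelPart (d k j : ℕ) : Subgroup (treeAut d) :=
  Subgroup.closure {g | ∃ n, HasExp g n ∧ (2 : ℤ) ^ j ∣ n ∧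
    ∃ u : List (Fin d), u.length = k ∧ ∀ w, ¬ u <+: w → g.1 w = w}

theorem levelPart_le_map (k j : ℕ) :
    levelPart d k j ≤ (levelRist (groupG d) k).map (groupG d).subtype := by
  refine (Subgroup.closure_le _).2 ?_
  rintro g ⟨n, hn, -, u, hu, hg⟩
  exact ⟨⟨g, hn.mem⟩, Subgroup.subset_closure ⟨u, hu, hg⟩, rfl⟩

theorem levelPart_succ_le (k j : ℕ) : levelPart d k (j + 1) ≤ levelPart d k j := by
  refine Subgroup.closure_mono ?_
  rintro g ⟨n, hn, hj, hu⟩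
  exact ⟨n, hn, (pow_dvd_pow 2 j.le_succ).trans hj, hu⟩

theorem mem_levelRist_of_mem_levelPart {k j : ℕ} {g : groupG d} (hg : g.1 ∈ levelPart d k j) :
    g ∈ levelRist (groupG d) k := by
  obtain ⟨h, hh, e⟩ := levelPart_le_map k j hg
  rwa [← Subtype.ext (a1 := h) (a2 := g) e]

theorem mem_groupG_of_mem_levelPart {k j : ℕ} {g : treeAut d} (hg : g ∈ levelPart d k j) :
    g ∈ groupG d := by
  obtain ⟨h, -, rfl⟩ := levelPart_le_map k j hg
  exact h.2

theorem HasExp.mem_levelPart_zero {g : treeAut d} {n : ℤ} (hg : HasExp g n) {j : ℕ}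
    (hj : (2 : ℤ) ^ j ∣ n) : g ∈ levelPart d 0 j :=
  Subgroup.subset_closure ⟨n, hg, hj, [], rfl, fun _ hw => absurd List.nil_prefix hw⟩

/-- One level costs one factor of two, because `delta x` halves exponents. The hypothesis `j + 2`
rather than `j + 1` supplies the divisibility by 4 needed to stay in the group. -/
theorem delta_mem_levelPart (hd : 3 ≤ d) (hodd : Odd d) (x : Fin d) {k j : ℕ} {h : treeAut d}
    (hh : h ∈ levelPart d k (j + 2)) : delta x h ∈ levelPart d (k + 1) (j + 1) := by
  suffices H : levelPart d k (j + 2) ≤ (levelPart d (k + 1) (j + 1)).comap (delta x) from H hh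
  refine (Subgroup.closure_le _).2 ?_
  rintro g ⟨n, hn, ⟨c, rfl⟩, u, hu, hg⟩
  rw [show (2 : ℤ) ^ (j + 2) * c = 4 * (2 ^ j * c) by ring] at hn
  refine Subgroup.subset_closure ⟨_, hn.delta hd hodd x, ⟨c, by ring⟩, x :: u,
    by simp [hu], ?_⟩
  rintro (_ | ⟨y, w⟩) hw
  · exact (delta x g).2.1
  · by_cases hy : y = x
    · subst hy
      rw [delta_cons_self, hg w fun h => hw (by simpa using h)]
    · exact delta_cons_of_ne hy _ _

theorem wreath_mem_levelPart (hd : 3 ≤ d) (hodd : Odd d) {k j : ℕ} {s : Fin d → treeAut d}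
    (hs : ∀ x, s x ∈ levelPart d k (j + 2)) : wreath s ∈ levelPart d (k + 1) (j + 1) :=
  wreath_mem fun x => delta_mem_levelPart hd hodd x (hs x)

theorem finiteIndex_of_map {H α : Type*} [Group H] [Finite α] {K : Subgroup H} (f : H → α)
    (hf : ∀ g h, f g = f h → g⁻¹ * h ∈ K) : K.FiniteIndex := by
  have : Finite (H ⧸ K) := by
    refine Finite.of_injective (fun q : H ⧸ K => f q.out) fun q r hqr => ?_
    rw [← Quotient.out_eq q, ← Quotient.out_eq r]
    exact QuotientGroup.eq.2 (hf _ _ hqr)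
  exact Subgroup.finiteIndex_of_finite_quotient

/-- The induction needs all `j` at once, since descending a level raises `j`. Elements with the same
first-level permutation and the same cosets of sections differ by a `wreath` of elements of the
smaller-level subgroup. -/
theorem finiteIndex_levelPart (hd : 3 ≤ d) (hodd : Odd d) (k j : ℕ) :
    ((levelPart d k j).comap (groupG d).subtype).FiniteIndex := by
  induction k generalizing j with
  | zero =>
    choose e he using fun g : groupG d => mem_groupG_iff.1 g.2
    refine finiteIndex_of_map (α := ZMod (2 ^ j)) (fun g => (e g : ZMod (2 ^ j))) ?_
    intro g h hgh
    refine Subgroup.mem_comap.2 (((he g).inv.mul (he h)).mem_levelPart_zero ?_)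
    rw [← sub_eq_neg_add]
    have := (ZMod.intCast_eq_intCast_iff_dvd_sub _ _ _).1 hgh
    exact_mod_cast this
  | succ k ih =>
    have hs : ∀ g : groupG d, ∃ (p : Equiv.Perm (Fin d)) (s : Fin d → groupG d),
        ∀ x w, g.1.1 (x :: w) = p x :: (s x).1.1 w := by
      intro g
      obtain ⟨n, hn⟩ := mem_groupG_iff.1 g.2
      obtain ⟨p, s, m, h1, h2, -⟩ := hn.exists_sections hd
      exact ⟨p, fun x => ⟨s x, (h2 x).mem⟩, h1⟩
    choose p s hps using hs
    let N := (levelPart d k (j + 2)).comap (groupG d).subtype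
    have : N.FiniteIndex := ih (j + 2)
    refine finiteIndex_of_map (α := Equiv.Perm (Fin d) × (Fin d → groupG d ⧸ N))
      (fun g => (p g, fun x => (s g x : groupG d ⧸ N))) ?_
    intro g h hgh
    obtain ⟨hp, hs⟩ := Prod.mk.inj hgh
    have e : (g⁻¹ * h).1 = wreath fun x => ((s g x)⁻¹ * s h x).1 := by
      refine treeAut_ext fun x w => ?_
      change (g.1.1)⁻¹ (h.1.1 (x :: w)) = x :: ((s g x).1.1)⁻¹ ((s h x).1.1 w)
      rw [Equiv.Perm.inv_eq_iff_eq, hps, hps, hp]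
      simp
    refine Subgroup.mem_comap.2 ?_
    change (g⁻¹ * h).1 ∈ _
    rw [e]
    refine levelPart_succ_le _ _ (wreath_mem_levelPart hd hodd fun x => ?_)
    have hx : (s g x : groupG d ⧸ N) = s h x := congrFun hs x
    exact Subgroup.mem_comap.1 (QuotientGroup.eq.1 hx)

theorem isBranch_groupG (hd : 3 ≤ d) (hodd : Odd d) : IsBranch (groupG d) := by
  refine ⟨fun u v h => ?_, fun k => ?_⟩
  · obtain ⟨g, hg, e⟩ := exists_apply_eq hd hodd u v h
    exact ⟨⟨g, hg⟩, e⟩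
  · have := finiteIndex_levelPart hd hodd k 0
    exact Subgroup.finiteIndex_of_le (H := (levelPart d k 0).comap (groupG d).subtype)
      fun g hg => mem_levelRist_of_mem_levelPart (Subgroup.mem_comap.1 hg)

/-! ### Sections of the elements of the rigid stabilizers -/

/-- Along the path to `u` only one section is nontrivial, so it carries the whole doubled exponent
at every step. -/
theorem HasExp.exists_section_of_supported (hd : 3 ≤ d) {g : treeAut d} {n : ℤ}
    (hg : HasExp g n) (u : List (Fin d)) (hu : ∀ w, ¬ u <+: w → g.1 w = w) :
    ∃ h, HasExp h (2 ^ u.length * n) ∧ ∀ w, g.1 (u ++ w) = u ++ h.1 w := by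
  induction u generalizing g n with
  | nil => exact ⟨g, by simpa using hg, fun w => rfl⟩
  | cons x u ih =>
    obtain ⟨p, s, m, hps, hm, hsum, -⟩ := hg.exists_sections hd
    have h1 : ∀ y, y ≠ x → p y = y ∧ s y = 1 := by
      intro y hy
      have h2 : ∀ w, p y :: (s y).1 w = y :: w := fun w => by
        rw [← hps]
        exact hu _ fun h => hy (List.cons_prefix_cons.1 h).1.symm
      exact ⟨(List.cons.inj (h2 [])).1,
        Subtype.ext (Equiv.ext fun w => (List.cons.inj (h2 w)).2)⟩
    have hpx : p x = x := by
      by_contra h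
      exact h (p.injective (h1 _ h).1)
    rw [Fintype.sum_eq_single x fun y hy => by
      have := hm y
      rw [(h1 y hy).2] at this
      exact this.unique hd HasExp.one] at hsum
    obtain ⟨h, hh, hh'⟩ := ih (hm x) fun w hw => by
      have := hu (x :: w) fun h => hw (by simpa using h)
      rw [hps] at this
      exact (List.cons.inj this).2
    refine ⟨h, ?_, fun w => ?_⟩
    · rw [List.length_cons, pow_succ, mul_assoc, ← hsum]
      exact hh
    · rw [List.cons_append, hps, hpx, hh']
      rfl

/-- The sections at level `k` of an element of the rigid stabilizer of level `k` have exponent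
sums divisible by `2 ^ (k + 1)`. -/
theorem exists_section_of_mem_levelRist (hd : 3 ≤ d) {u : List (Fin d)} (hu : u ≠ [])
    {g : groupG d} (hg : g ∈ levelRist (groupG d) u.length) :
    ∃ h n, HasExp h (2 ^ (u.length + 1) * n) ∧ ∀ w, g.1.1 (u ++ w) = u ++ h.1 w := by
  induction hg using Subgroup.closure_induction with
  | mem g hg =>
    obtain ⟨v, hv, hg⟩ := hg
    obtain ⟨n, hn⟩ := mem_groupG_iff.1 g.2
    by_cases huv : v = u
    · subst huv
      obtain ⟨h, hh, hh'⟩ := hn.exists_section_of_supported hd v hg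
      -- The additional factor 2: below a nonempty `v` the element fixes the first level, so its
      -- exponent is even by the sign.
      have hev : Even n := by
        obtain ⟨p, s, m, hps, -, -, hp⟩ := hn.exists_sections hd
        have hp1 : p = 1 := by
          ext x : 1
          have h1 := levelRist_le_levelStab _ 1 (levelRist_antitone _
            (List.length_pos_iff.2 hu) (Subgroup.subset_closure ⟨v, rfl, hg⟩)) [x] rfl
          rw [hps] at h1
          exact (List.cons.inj h1).1
        exact even_of_sign n (by rw [← hp, hp1, map_one])
      obtain ⟨r, rfl⟩ := hev
      refine ⟨h, r, ?_, hh'⟩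
      rwa [pow_succ, mul_assoc, two_mul]
    · refine ⟨1, 0, by simpa using HasExp.one, fun w => ?_⟩
      refine hg _ fun h => huv ?_
      exact List.IsPrefix.eq_of_length (List.prefix_of_prefix_length_le h
        (List.prefix_append u w) hv.le) hv
  | one => exact ⟨1, 0, by simpa using HasExp.one, fun w => rfl⟩
  | mul a b _ _ ha hb =>
    obtain ⟨h, m, hm, hh⟩ := ha
    obtain ⟨k, n, hn, hk⟩ := hb
    refine ⟨h * k, m + n, by rw [mul_add]; exact hm.mul hn, fun w => ?_⟩
    change a.1.1 (b.1.1 (u ++ w)) = _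
    rw [hk, hh]
    rfl
  | inv a _ ha =>
    obtain ⟨h, m, hm, hh⟩ := ha
    refine ⟨h⁻¹, -m, by rw [mul_neg]; exact hm.inv, fun w => ?_⟩
    change (a.1.1)⁻¹ (u ++ w) = _
    rw [Equiv.Perm.inv_eq_iff_eq, hh]
    simp

/-- The test by which powers are shown to be nontrivial in the rigid kernel: the section of `g ^ n`
at `u` is `h ^ n`, whose exponent is unique. -/
theorem dvd_of_pow_mem_levelRist (hd : 3 ≤ d) {u : List (Fin d)} (hu : u ≠ [])
    {g : groupG d} {h : treeAut d} {m : ℤ} (hm : HasExp h m)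
    (hgh : ∀ w, g.1.1 (u ++ w) = u ++ h.1 w) {n : ℕ}
    (hg : g ^ n ∈ levelRist (groupG d) u.length) : (2 : ℤ) ^ (u.length + 1) ∣ n * m := by
  obtain ⟨k, c, hc, hk⟩ := exists_section_of_mem_levelRist hd hu hg
  have h1 : ∀ n : ℕ, ∀ w, (g ^ n).1.1 (u ++ w) = u ++ (h ^ n).1 w := by
    intro n
    induction n with
    | zero => intro w; rfl
    | succ n ih =>
      intro w
      rw [pow_succ, pow_succ]
      change (g ^ n).1.1 (g.1.1 (u ++ w)) = u ++ (h ^ n).1 (h.1 w)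
      rw [hgh, ih]
  have h2 : k = h ^ n := by
    refine Subtype.ext (Equiv.ext fun w => List.append_cancel_left (as := u) ?_)
    rw [← hk, h1]
  rw [h2] at hc
  exact ⟨c, (hm.pow n).unique hd hc⟩

/-! ### Elements of the rigid kernel -/

/-- The condition `hc` makes the cosets of the `g k` coherent in the branch completion, and `hg`
makes their images in the congruence completion trivial. -/
theorem exists_rigidKernel (G : Subgroup (treeAut d)) (g : ℕ → G)
    (hg : ∀ k, g k ∈ levelStab G k) (hc : ∀ k, (g k)⁻¹ * g (k + 1) ∈ levelRist G k) :
    ∃ x : rigidKernel G, ∀ n : ℕ, x ^ n = 1 ↔ ∀ k, g k ^ n ∈ levelRist G k := by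
  have hcl : ∀ k l, k ≤ l → (g k)⁻¹ * g l ∈ levelRist G k := by
    intro k l hkl
    induction l, hkl using Nat.le_induction with
    | base => rw [inv_mul_cancel]; exact one_mem _
    | succ l hkl ih =>
      have := mul_mem ih (levelRist_antitone G hkl (hc l))
      simpa [mul_assoc] using this
  let y : branchCompletion G := ⟨fun k => (g k : G ⧸ levelRist G k), fun k l hkl =>
    (QuotientGroup.eq.2 (hcl k l hkl)).symm⟩
  have hy : y ∈ rigidKernel G := by
    refine MonoidHom.mem_ker.2 (Subtype.ext (funext fun k => ?_))
    exact (QuotientGroup.eq_one_iff (N := levelStab G k) (g k)).2 (hg k)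
  refine ⟨⟨y, hy⟩, fun n => ?_⟩
  rw [← Subtype.coe_inj, ← Subtype.coe_inj, funext_iff]
  exact forall_congr' fun k => QuotientGroup.eq_one_iff (N := levelRist G k) (g k ^ n)

/-- Two adjacent copies of an automorphism. -/
def twin (i : Fin d) : treeAut d →* treeAut d where
  toFun h := wreath fun x => if x = i ∨ x = finRotate d i then h else 1
  map_one' := by
    simp only [ite_self]
    exact map_one wreath
  map_mul' g h := by
    rw [← map_mul]
    refine congrArg wreath (funext fun x => ?_)
    rw [Pi.mul_apply]
    split_ifs <;> simp

theorem twin_cons (i : Fin d) (h : treeAut d) (w : List (Fin d)) :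
    (twin i h).1 (i :: w) = i :: h.1 w := by
  change i :: (ite (i = i ∨ i = finRotate d i) h 1 : treeAut d).1 w = _
  rw [if_pos (Or.inl rfl)]

theorem twin_eq (hd : 3 ≤ d) (i : Fin d) (h : treeAut d) :
    twin i h = delta i h * delta (finRotate d i) h := by
  have hne := finRotate_ne_self hd i
  refine treeAut_ext fun x w => ?_
  change x :: (ite (x = i ∨ x = finRotate d i) h 1 : treeAut d).1 w =
    (delta i h).1 ((delta (finRotate d i) h).1 (x :: w))
  by_cases hx : x = finRotate d i
  · subst hx
    rw [if_pos (Or.inr rfl), delta_cons_self, delta_cons_of_ne hne]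
  · rw [delta_cons_of_ne hx]
    by_cases hi : x = i
    · subst hi
      rw [if_pos (Or.inl rfl), delta_cons_self]
    · rw [if_neg (by tauto), delta_cons_of_ne hi]
      rfl

theorem twin_mem_levelPart (hd : 3 ≤ d) (hodd : Odd d) (i : Fin d) {k j : ℕ} {h : treeAut d}
    (hh : h ∈ levelPart d k (j + 2)) : twin i h ∈ levelPart d (k + 1) (j + 1) := by
  rw [twin_eq hd]
  exact mul_mem (delta_mem_levelPart hd hodd _ hh) (delta_mem_levelPart hd hodd _ hh)

theorem wreath_fixes {s : Fin d → treeAut d} {k : ℕ}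
    (hs : ∀ x u, u.length = k → (s x).1 u = u) :
    ∀ u : List (Fin d), u.length = k + 1 → (wreath s).1 u = u := by
  rintro (_ | ⟨x, u⟩) hu
  · simp at hu
  · rw [wreath_cons, hs x u (by simpa using hu)]

theorem twin_fixes (i : Fin d) {h : treeAut d} {k : ℕ}
    (hh : ∀ u : List (Fin d), u.length = k → h.1 u = u) :
    ∀ u : List (Fin d), u.length = k + 1 → (twin i h).1 u = u :=
  wreath_fixes fun x u hu => by
    split_ifs
    · exact hh u hu
    · rfl

theorem iterate_fixes {f : treeAut d → treeAut d} (hf : ∀ (h : treeAut d) (k : ℕ),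
      (∀ u : List (Fin d), u.length = k → h.1 u = u) → ∀ u : List (Fin d), u.length = k + 1 →
        (f h).1 u = u) (h : treeAut d) (k : ℕ) (u : List (Fin d)) (hu : u.length = k) :
    (f^[k] h).1 u = u := by
  induction k generalizing u with
  | zero =>
    rw [List.length_eq_zero_iff.1 hu]
    exact h.2.1
  | succ k ih =>
    rw [Function.iterate_succ_apply']
    exact hf _ k ih u hu

theorem iterate_replicate {f : treeAut d → treeAut d} {i : Fin d}
    (hf : ∀ h w, (f h).1 (i :: w) = i :: h.1 w) (h : treeAut d) (k : ℕ) (w : List (Fin d)) :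
    (f^[k] h).1 (List.replicate k i ++ w) = List.replicate k i ++ h.1 w := by
  induction k with
  | zero => rfl
  | succ k ih =>
    rw [Function.iterate_succ_apply', List.replicate_succ, List.cons_append, hf, ih,
      List.cons_append]

/-- The automorphism with sections `a_i ^ 2` at the words of length `k` in `i` and `i + 1`. -/
def fullTwin (i : Fin d) (k : ℕ) : treeAut d := (twin i)^[k] (gen i ^ 2)

/-- `twin i` preserves the exponent 2, as two sections of exponent 2 sum to twice 2. The value is
read off from the square, a product of two elements covered by `HasExp.delta`. -/
theorem hasExp_twin_gen_sq (hd : 3 ≤ d) (hodd : Odd d) (i : Fin d) :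
    HasExp (twin i (gen i ^ 2)) 2 := by
  have h2 : HasExp (gen i ^ 2) 2 := by simpa using (HasExp.gen i).pow 2
  have hG : twin i (gen i ^ 2) ∈ groupG d := by
    rw [twin_eq hd]
    exact delta_mul_delta_mem hd hodd i h2 h2
  obtain ⟨n, hn⟩ := mem_groupG_iff.1 hG
  have h4 : HasExp (twin i (gen i ^ 2) * twin i (gen i ^ 2)) 4 := by
    rw [← map_mul, ← pow_add, twin_eq hd]
    have h : HasExp (gen i ^ (2 + 2)) (4 * 1) := by simpa using (HasExp.gen i).pow 4
    simpa using (h.delta hd hodd i).mul (h.delta hd hodd (finRotate d i))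
  have := (hn.mul hn).unique hd h4
  rwa [show (2 : ℤ) = n by omega]

/-- At level 0 the quotient has exponent 2 - 2 = 0, divisible by every power of two; this pays for
the loss at each application of `twin i`. -/
theorem fullTwin_inv_mul_mem (hd : 3 ≤ d) (hodd : Odd d) (i : Fin d) (k j : ℕ) :
    (fullTwin i k)⁻¹ * fullTwin i (k + 1) ∈ levelPart d k j := by
  induction k generalizing j with
  | zero =>
    have h2 : HasExp (gen i ^ 2) 2 := by simpa using (HasExp.gen i).pow 2
    exact (h2.inv.mul (hasExp_twin_gen_sq hd hodd i)).mem_levelPart_zero (by simp)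
  | succ k ih =>
    have := levelPart_succ_le _ _ (twin_mem_levelPart hd hodd i (ih (j + 2)))
    rw [map_mul, map_inv] at this
    simpa only [fullTwin, Function.iterate_succ_apply'] using this

theorem fullTwin_mem (hd : 3 ≤ d) (hodd : Odd d) (i : Fin d) (k : ℕ) :
    fullTwin i k ∈ groupG d := by
  induction k with
  | zero => exact pow_mem (gen_mem i) 2
  | succ k ih =>
    simpa using mul_mem ih (mem_groupG_of_mem_levelPart (fullTwin_inv_mul_mem hd hodd i k 0))

theorem exists_not_isOfFinOrder (hd : 3 ≤ d) (hodd : Odd d) :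
    ∃ x : rigidKernel (groupG d), ¬ IsOfFinOrder x := by
  let i : Fin d := ⟨0, by omega⟩
  obtain ⟨x, hx⟩ := exists_rigidKernel (groupG d)
    (fun k => ⟨fullTwin i k, fullTwin_mem hd hodd i k⟩)
    (fun k => iterate_fixes (fun h k => twin_fixes i) _ k)
    (fun k => mem_levelRist_of_mem_levelPart (j := 0) (fullTwin_inv_mul_mem hd hodd i k 0))
  refine ⟨x, fun h => ?_⟩
  obtain ⟨n, hn, hxn⟩ := isOfFinOrder_iff_pow_eq_one.1 h
  -- The level is chosen in terms of `n`: at level `n + 1` the test requires `2 ^ (n + 2)` to divide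
  -- `n * 2`, which is too small.
  have h2 := dvd_of_pow_mem_levelRist hd (u := List.replicate (n + 1) i) (by simp)
    (g := ⟨fullTwin i (n + 1), fullTwin_mem hd hodd i (n + 1)⟩)
    (h := gen i ^ 2) (m := 2) (by simpa using (HasExp.gen i).pow 2)
    (iterate_replicate (fun h w => twin_cons i h w) _ (n + 1)) (n := n)
    (by rw [List.length_replicate]; exact (hx n).1 hxn (n + 1))
  rw [List.length_replicate, pow_succ] at h2
  have h3 := Int.le_of_dvd (by omega) (Int.dvd_of_mul_dvd_mul_right (by norm_num) h2)
  have h4 : n + 1 < 2 ^ (n + 1) := Nat.lt_two_pow_self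
  have h5 : ((n + 1 : ℕ) : ℤ) < ((2 ^ (n + 1) : ℕ) : ℤ) := by exact_mod_cast h4
  push_cast at h5
  omega

/-! ### An element of order two in the rigid kernel. -/

theorem HasExp.iterate_delta (hd : 3 ≤ d) (hodd : Odd d) (i : Fin d) (k : ℕ) (c : ℕ) :
    HasExp ((RigidKernel.delta i)^[k] (RigidKernel.gen i ^ (2 ^ (k + 1) * c))) (2 * c) := by
  induction k generalizing c with
  | zero =>
    have := (HasExp.gen i).pow (2 * c)
    simpa using this
  | succ k ih =>
    have := ih (2 * c)
    rw [Function.iterate_succ_apply']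
    refine HasExp.delta hd hodd i ?_
    convert this using 1
    · congr 2
      ring
    · push_cast
      ring

/-- The automorphism supported on the subtree at `i ^ k`, with section `a_i ^ (2 ^ (k + 1) * c)`
there. -/
def spike (i : Fin d) (k c : ℕ) : treeAut d := (delta i)^[k] (gen i ^ (2 ^ (k + 1) * c))

theorem spike_succ (i : Fin d) (k c : ℕ) : spike i (k + 1) c = delta i (spike i k (2 * c)) := by
  rw [spike, spike, Function.iterate_succ_apply']
  congr 3
  ring

/-- A spike has exponent `2 * c` whatever its length, so at level 0 the quotient has exponent 0. The
parameter `c` is free because removing the outermost `delta i` doubles it. -/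
theorem spike_inv_mul_mem (hd : 3 ≤ d) (hodd : Odd d) (i : Fin d) (k j c : ℕ) :
    (spike i k c)⁻¹ * spike i (k + 1) c ∈ levelPart d k j := by
  induction k generalizing j c with
  | zero =>
    exact ((HasExp.iterate_delta hd hodd i 0 c).inv.mul
      (HasExp.iterate_delta hd hodd i 1 c)).mem_levelPart_zero (by simp)
  | succ k ih =>
    have := levelPart_succ_le _ _ (delta_mem_levelPart hd hodd i (ih (j + 2) (2 * c)))
    rwa [map_mul, map_inv, ← spike_succ, ← spike_succ] at this

/-- Two adjacent spikes, of total length `k`. -/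
def spikePair (i : Fin d) : ℕ → treeAut d
  | 0 => 1
  | k + 1 => twin i (spike i k 1)

theorem spikePair_one (i : Fin d) : spikePair i 1 = twin i (gen i ^ 2) := rfl

theorem spikePair_inv_mul_mem (hd : 3 ≤ d) (hodd : Odd d) (i : Fin d) (k : ℕ) :
    (spikePair i k)⁻¹ * spikePair i (k + 1) ∈ levelPart d k 0 := by
  rcases k with _ | k
  · rw [spikePair, inv_one, one_mul, spikePair_one]
    exact (hasExp_twin_gen_sq hd hodd i).mem_levelPart_zero (by simp)
  · rw [spikePair, spikePair, ← map_inv, ← map_mul]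
    exact levelPart_succ_le _ _ (twin_mem_levelPart hd hodd i (spike_inv_mul_mem hd hodd i k 2 1))

theorem spikePair_mem (hd : 3 ≤ d) (hodd : Odd d) (i : Fin d) (k : ℕ) :
    spikePair i k ∈ groupG d := by
  induction k with
  | zero => exact one_mem _
  | succ k ih =>
    simpa using mul_mem ih (mem_groupG_of_mem_levelPart (spikePair_inv_mul_mem hd hodd i k))

theorem delta_fixes (i : Fin d) (h : treeAut d) (k : ℕ)
    (hh : ∀ u : List (Fin d), u.length = k → h.1 u = u) :
    ∀ u : List (Fin d), u.length = k + 1 → (delta i h).1 u = u := by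
  rintro (_ | ⟨x, u⟩) hu
  · simp at hu
  · by_cases hx : x = i
    · subst hx
      rw [delta_cons_self, hh u (by simpa using hu)]
    · exact delta_cons_of_ne hx _ _

theorem spikePair_fixes (i : Fin d) (k : ℕ) :
    ∀ u : List (Fin d), u.length = k → (spikePair i k).1 u = u := by
  rcases k with _ | k
  · exact fun _ _ => rfl
  · exact twin_fixes i (iterate_fixes (delta_fixes i) _ k)

/-- Factors of two in `c` raise the divisibility at the tip. For `j = 1` there is enough to survive
a further `twin i`, which puts the squares of the spike pairs in the rigid stabilizers. -/
theorem spike_mem_levelPart (hd : 3 ≤ d) (hodd : Odd d) (i : Fin d) (k j c : ℕ) :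
    spike i k (2 ^ j * c) ∈ levelPart d k (j + 1) := by
  induction k generalizing j with
  | zero =>
    refine (HasExp.iterate_delta hd hodd i 0 (2 ^ j * c)).mem_levelPart_zero ?_
    exact ⟨c, by push_cast; ring⟩
  | succ k ih =>
    rw [spike_succ]
    refine delta_mem_levelPart hd hodd i ?_
    rw [← mul_assoc, ← pow_succ']
    exact ih (j + 1)

theorem spikePair_sq_mem (hd : 3 ≤ d) (hodd : Odd d) (i : Fin d) (k : ℕ) :
    spikePair i k ^ 2 ∈ levelPart d k 0 := by
  rcases k with _ | k
  · rw [spikePair, one_pow]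
    exact one_mem _
  · have h : spike i k 1 ^ 2 = spike i k (2 ^ 1 * 1) := by
      rw [spike, spike, ← iterate_map_pow, ← pow_mul]
      congr 2
      ring
    rw [spikePair, ← map_pow, h]
    exact levelPart_succ_le _ _ (twin_mem_levelPart hd hodd i (spike_mem_levelPart hd hodd i k 1 1))

theorem exists_isOfFinOrder (hd : 3 ≤ d) (hodd : Odd d) :
    ∃ x : rigidKernel (groupG d), x ≠ 1 ∧ IsOfFinOrder x := by
  let i : Fin d := ⟨0, by omega⟩
  obtain ⟨x, hx⟩ := exists_rigidKernel (groupG d)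
    (fun k => ⟨spikePair i k, spikePair_mem hd hodd i k⟩)
    (spikePair_fixes i)
    (fun k => mem_levelRist_of_mem_levelPart (spikePair_inv_mul_mem hd hodd i k))
  refine ⟨x, fun h => ?_, isOfFinOrder_iff_pow_eq_one.2 ⟨2, two_pos, (hx 2).2 fun k =>
    mem_levelRist_of_mem_levelPart (j := 0) (spikePair_sq_mem hd hodd i k)⟩⟩
  -- Level 1 already detects `x`: the section `a_i ^ 2` has exponent 2, which is not divisible by 4.
  have h1 := (hx 1).1 (by rw [h, one_pow]) 1
  have h2 := dvd_of_pow_mem_levelRist hd (u := [i]) (by simp) (h := gen i ^ 2)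
    (m := 2) (by simpa using (HasExp.gen i).pow 2) (twin_cons i _) (n := 1) h1
  norm_num at h2

end RigidKernel

theorem mainTheorem12 (d : ℕ) (hd : 3 ≤ d) (hodd : Odd d) :
    RigidKernel.IsBranch (RigidKernel.groupG d) ∧
    Infinite (RigidKernel.rigidKernel (RigidKernel.groupG d)) ∧
    (∃ x : RigidKernel.rigidKernel (RigidKernel.groupG d), x ≠ 1 ∧ IsOfFinOrder x) ∧
    (∃ x : RigidKernel.rigidKernel (RigidKernel.groupG d), ¬ IsOfFinOrder x) := by
  have h := RigidKernel.exists_not_isOfFinOrder hd hodd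
  refine ⟨RigidKernel.isBranch_groupG hd hodd, ?_, RigidKernel.exists_isOfFinOrder hd hodd, h⟩
  obtain ⟨x, hx⟩ := h
  by_contra hfin
  have := not_infinite_iff_finite.1 hfin
  exact hx (isOfFinOrder_of_finite x)
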